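/- Let $\mathbb{F}$ be a finite field with $q$ elements and let $G=\langle g\rangle$ be a cyclic group (finite or infinite, written multiplicatively, with identity $e$) of order greater than $2$. Let $x_{i,h}$ ($i\ge 1$, $h\in G$) be free non-commuting variables, $x_{i,h}$ being of degree $h$; write $y_i=x_{i,e}$, $z_i=x_{i,g}$, $w_i=x_{i,g^{-1}}$, $X_i=y_i+z_i+w_i$ and $[a,b]=ab-ba$, and put $$f_1=y_1^q-y_1,\quad f_2=(X_1-X_1^q)(X_2-X_2^{q^2})\bigl(1-[X_1,X_2]^{q-1}\bigr),\quad f_3=z_1z_2,\quad f_4=w_1w_2.$$ Let $\widetilde M$ be the algebra $M_2(\mathbb{F})$ with the $G$-grading in which $\widetilde M_e$ is the set of diagonal matrices, $\widetilde M_g=\mathbb{F}E_{12}$, $\widetilde M_{g^{-1}}=\mathbb{F}E_{21}$, and $\widetilde M_h=0$ for all other $h$; let $\mathbb{F}$ carry the trivial grading. For a $G$-graded associative (not necessarily unital) $\mathbb{F}$-algebra $A=\bigoplus_{h\in G}A_h$, a polynomial is a graded identity of $A$ if it vanishes whenever each $x_{i,h}$ is replaced by an element of $A_h$. A graded right $A$-module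 is graded simple if $MA\neq 0$ and its only graded submodules are $0$ and $M$; the graded Jacobson radical $J^{gr}(A)$ is the intersection of the annihilators of all graded simple right $A$-modules, and $J^{gr}(A)=A$ if there are none. Let $A$ be a finite-dimensional $G$-graded associative $\mathbb{F}$-algebra, not necessarily unital, that satisfies the graded identities $f_1,f_2,f_3,f_4$ and $x_{1,h}$ for all $h\in G\setminus\{e,g,g^{-1}\}$. Then there exist a graded subalgebra $B$ of $A$, an integer $s\ge 0$ and graded subalgebras $B_1,\dots,B_s$ of $A$ such that $B=B_1\oplus\cdots\oplus B_s$ is a direct sum of algebras (a direct sum of subspaces with $B_iB_j=0$ for $i\ne j$), each $B_i$ is isomorphic as a graded algebra to $\mathbb{F}$ or to $\widetilde M$, and $A=B\oplus J^{gr}(A)$ as a vector space. -/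

import Mathlib

namespace GradedPI

universe u v w

section Gradings

variable {F : Type u} [Field F] {G : Type w} [Group G]

/-- `V = ⨁ h, 𝒱 h` as a vector space (internal direct sum of the family of subspaces). -/
structure IsVectorGrading {V : Type*} [AddCommGroup V] [Module F V]
    (𝒱 : G → Submodule F V) : Prop where
  indep : iSupIndep 𝒱
  span : ⨆ h, 𝒱 h = ⊤

/-- `𝒜` is a `G`-grading of the (associative, not necessarily unital) algebra `A`. -/
structure IsAlgebraGrading {A : Type*} [NonUnitalRing A] [Module F A]
    (𝒜 : G → Submodule F A) : Prop extends IsVectorGrading 𝒜 where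
  mul_mem : ∀ h k : G, ∀ a ∈ 𝒜 h, ∀ b ∈ 𝒜 k, a * b ∈ 𝒜 (h * k)

/-- A subspace `W` is graded if it is the sum of its homogeneous parts `W ∩ 𝒱 h`. -/
def IsGradedSubspace {V : Type*} [AddCommGroup V] [Module F V]
    (𝒱 : G → Submodule F V) (W : Submodule F V) : Prop :=
  W = ⨆ h, W ⊓ 𝒱 h

/-- The family of homogeneous parts `B ∩ A_h` of a subalgebra `B`, as subspaces of `B`. -/
def subalgebraGrading {A : Type*} [NonUnitalRing A] [Module F A]
    (𝒜 : G → Submodule F A) (B : NonUnitalSubalgebra F A) : G → Submodule F B :=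
  fun h => (𝒜 h).comap B.toSubmodule.subtype

/-- Isomorphism of graded algebras: a bijective algebra homomorphism (not assumed to respect
units) that maps each component of degree `h` into the component of degree `h`. -/
def GradedIsomorphic {A B : Type*} [NonUnitalRing A] [Module F A] [NonUnitalRing B] [Module F B]
    (𝒜 : G → Submodule F A) (ℬ : G → Submodule F B) : Prop :=
  ∃ φ : A →ₙₐ[F] B, Function.Bijective φ ∧ ∀ h : G, ∀ a ∈ 𝒜 h, φ a ∈ ℬ h

/-- The trivial grading of the algebra `F`: everything has degree `1`. -/
def trivialGrading (F : Type u) [Field F] (G : Type w) [Group G] : G → Submodule F F :=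
  fun h =>
    { carrier := {c | h ≠ 1 → c = 0}
      zero_mem' := fun _ => rfl
      add_mem' := fun ha hb hh => by rw [ha hh, hb hh, add_zero]
      smul_mem' := fun c x hx hh => by rw [hx hh, smul_zero] }

/-- The grading of `M₂(F)` in which the diagonal matrices have degree `1`, the multiples of
`E₁₂` have degree `g`, the multiples of `E₂₁` have degree `g⁻¹`, and all other
components are zero. -/
def matrixGrading (F : Type u) [Field F] {G : Type w} [Group G] (g : G) :
    G → Submodule F (Matrix (Fin 2) (Fin 2) F) :=
  fun h =>
    { carrier := {m | (h ≠ 1 → m 0 0 = 0 ∧ m 1 1 = 0) ∧ (h ≠ g → m 0 1 = 0) ∧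
        (h ≠ g⁻¹ → m 1 0 = 0)}
      zero_mem' := ⟨fun _ => ⟨rfl, rfl⟩, fun _ => rfl, fun _ => rfl⟩
      add_mem' := fun ha hb =>
        ⟨fun hh => ⟨by simp [(ha.1 hh).1, (hb.1 hh).1], by simp [(ha.1 hh).2, (hb.1 hh).2]⟩,
          fun hh => by simp [ha.2.1 hh, hb.2.1 hh], fun hh => by simp [ha.2.2 hh, hb.2.2 hh]⟩
      smul_mem' := fun c m hm =>
        ⟨fun hh => ⟨by simp [(hm.1 hh).1], by simp [(hm.1 hh).2]⟩,
          fun hh => by simp [hm.2.1 hh], fun hh => by simp [hm.2.2 hh]⟩ }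

end Gradings

section Radical

variable {F : Type u} [Field F] {G : Type w} [Group G]

/-- `M`, with the bilinear right action `m · a = act m a` of the not necessarily unital algebra `A`
and the family `ℳ` of subspaces, is a graded right `A`-module. -/
structure IsGradedRightModule {A : Type v} [NonUnitalRing A] [Module F A]
    (𝒜 : G → Submodule F A) {M : Type v} [AddCommGroup M] [Module F M]
    (act : M →ₗ[F] A →ₗ[F] M) (ℳ : G → Submodule F M) : Prop extends IsVectorGrading ℳ where
  act_mul : ∀ (m : M) (a b : A), act m (a * b) = act (act m a) b
  act_mem : ∀ h k : G, ∀ m ∈ ℳ h, ∀ a ∈ 𝒜 k, act m a ∈ ℳ (h * k)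

/-- A graded right module is graded simple if `M A ≠ 0` and its only graded submodules are
`0` and `M`. -/
structure IsGradedSimpleRightModule {A : Type v} [NonUnitalRing A] [Module F A]
    (𝒜 : G → Submodule F A) {M : Type v} [AddCommGroup M] [Module F M]
    (act : M →ₗ[F] A →ₗ[F] M) (ℳ : G → Submodule F M) : Prop
    extends IsGradedRightModule 𝒜 act ℳ where
  act_ne_zero : ∃ (m : M) (a : A), act m a ≠ 0
  eq_bot_or_eq_top : ∀ N : Submodule F M, IsGradedSubspace ℳ N →
    (∀ m ∈ N, ∀ a : A, act m a ∈ N) → N = ⊥ ∨ N = ⊤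

/-- The graded Jacobson radical: the intersection of the annihilators of all graded simple right
`A`-modules (all of `A` if there are none). The modules range over the universe of `A`; this is no
restriction, since a graded simple module equals `m A` for any nonzero homogeneous `m`, so it is
a quotient of `A`. -/
def gradedJacobson {A : Type v} [NonUnitalRing A] [Module F A]
    (𝒜 : G → Submodule F A) : Submodule F A where
  carrier := {a | ∀ (M : Type v) [AddCommGroup M] [Module F M]
    (act : M →ₗ[F] A →ₗ[F] M) (ℳ : G → Submodule F M),
    IsGradedSimpleRightModule 𝒜 act ℳ → ∀ m : M, act m a = 0}
  zero_mem' := fun _ _ _ act _ _ m => map_zero (act m)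
  add_mem' := fun ha hb M _ _ act ℳ hM m => by
    rw [map_add, ha M act ℳ hM m, hb M act ℳ hM m, add_zero]
  smul_mem' := fun c a ha M _ _ act ℳ hM m => by
    rw [map_smul, ha M act ℳ hM m, smul_zero]

end Radical

section Identities

variable (F : Type u) [Field F] {G : Type w} [Group G]

/-- The free variable `x_{i,h}` of degree `h`. The free algebra is taken with unit, so that
expressions such as `p * (1 - r)` make sense. -/
def x (i : ℕ) (h : G) : FreeAlgebra F (ℕ × G) := FreeAlgebra.ι F (i, h)

variable {F}

/-- `f` is a graded polynomial identity of `A`: it vanishes under all substitutions that send each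
`x_{i,h}` to an element of `A_h`. The value is computed in the unitization of `A`;
for `f` without constant term it lies in `A`. -/
def IsGradedIdentity {A : Type v} [NonUnitalRing A] [Module F A] [IsScalarTower F A A]
    [SMulCommClass F A A] (𝒜 : G → Submodule F A) (f : FreeAlgebra F (ℕ × G)) : Prop :=
  ∀ ψ : ℕ × G → A, (∀ i h, ψ (i, h) ∈ 𝒜 h) →
    FreeAlgebra.lift F (fun p => (Unitization.inr (ψ p) : Unitization F A)) f = 0

variable (F)

/-- `f₁ = y₁^q - y₁` with `y₁ = x_{1,e}`. -/
def f₁ (G : Type w) [Group G] (q : ℕ) : FreeAlgebra F (ℕ × G) :=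
  x F 1 (1 : G) ^ q - x F 1 (1 : G)

/-- `X_i = y_i + z_i + w_i`, the sum of the variables of degrees `e`, `g` and `g⁻¹`. -/
def bigX (g : G) (i : ℕ) : FreeAlgebra F (ℕ × G) :=
  x F i 1 + x F i g + x F i g⁻¹

/-- `f₂ = (X₁ - X₁^q)(X₂ - X₂^(q²))(1 - [X₁, X₂]^(q-1))`. -/
def f₂ (g : G) (q : ℕ) : FreeAlgebra F (ℕ × G) :=
  (bigX F g 1 - bigX F g 1 ^ q) * (bigX F g 2 - bigX F g 2 ^ (q ^ 2)) *
    (1 - (bigX F g 1 * bigX F g 2 - bigX F g 2 * bigX F g 1) ^ (q - 1))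

/-- `f₃ = z₁ z₂`. -/
def f₃ (g : G) : FreeAlgebra F (ℕ × G) := x F 1 g * x F 2 g

/-- `f₄ = w₁ w₂`. -/
def f₄ (g : G) : FreeAlgebra F (ℕ × G) := x F 1 g⁻¹ * x F 2 g⁻¹

/-- The polynomials `f₁, f₂, f₃, f₄` and `x_{1,h}` for `h ∉ {e, g, g⁻¹}`. -/
def identitySet (g : G) (q : ℕ) : Set (FreeAlgebra F (ℕ × G)) :=
  {f₁ F G q, f₂ F g q, f₃ F g, f₄ F g} ∪
    {f | ∃ h : G, h ∉ ({1, g, g⁻¹} : Set G) ∧ f = x F 1 h}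

end Identities

end GradedPI

/-! Put Y = A_1, Z = A_g, W = A_{g⁻¹}; all other components vanish. The identity y^q = y makes Y
reduced and spanned by idempotents, hence commutative, so Y is a product of copies of F with a
finite set S of primitive orthogonal idempotents.

Since ZZ = WW = 0, the structure lies in the products between Z and W. If e(zw) ≠ 0 with e ∈ S, this
is a nonzero multiple of e, so a = ez has a partner b with ab = e, and f = ba turns out to lie in S
again (`exists_isMatched`): e, a, b, f are matrix units. The vanishing of ZZ and the commutativity
of Y make this relation a partial matching of S (`not_isMatched_chain`, `isMatched_right_unique`).
Matched pairs span copies of the graded M₂(F), unmatched idempotents span copies of F, and these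
blocks are mutually orthogonal.

The rest is radical. An element of Z minus its matched corners annihilates W, and the elements of Z
annihilating W form a left ideal of square zero (`mem_gradedJacobson_of_mul_eq_zero`); W is
symmetric. Conversely, a nonzero idempotent of degree 1 acts nontrivially on a graded simple
quotient of A, so the radical meets Y in 0 (`gradedJacobson_inf_degree_one`). It then misses every
block, because multiplying by matrix units moves each coordinate of a block element into F e ⊆ Y. -/

namespace GradedPI

universe u v w

/-! ### Homogeneous components and graded subspaces -/

section Gradings

variable {F : Type u} [Field F]

/-- A family of subspaces is independent if it admits projections. -/
theorem iSupIndep_of_proj {V ι : Type*} [AddCommGroup V] [Module F V]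
    {𝒱 : ι → Submodule F V} (p : ι → V →ₗ[F] V) (hp : ∀ i, ∀ v ∈ 𝒱 i, p i v = v)
    (hp' : ∀ i j, j ≠ i → ∀ v ∈ 𝒱 j, p i v = 0) : iSupIndep 𝒱 := by
  intro i
  rw [Submodule.disjoint_def]
  intro v hv hv'
  have hle : (⨆ j, ⨆ (_ : j ≠ i), 𝒱 j) ≤ LinearMap.ker (p i) :=
    iSup₂_le fun j hj v hv => hp' i j hj v hv
  rw [← hp i v hv]
  exact hle hv'

variable {G : Type w}

/-- The homogeneous components of a graded vector space. -/
theorem IsVectorGrading.exists_proj {V : Type*} [AddCommGroup V] [Module F V]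
    {𝒱 : G → Submodule F V} (h𝒱 : IsVectorGrading 𝒱) :
    ∃ p : G → V →ₗ[F] V, (∀ h v, p h v ∈ 𝒱 h) ∧ (∀ h, ∀ v ∈ 𝒱 h, p h v = v) ∧
      (∀ h k, k ≠ h → ∀ v ∈ 𝒱 k, p h v = 0) ∧
      ∀ W : Submodule F V, ∀ v, (∀ h, p h v ∈ W) → v ∈ W := by
  classical
  have hint : DirectSum.IsInternal 𝒱 :=
    (DirectSum.isInternal_submodule_iff_iSupIndep_and_iSup_eq_top 𝒱).2 ⟨h𝒱.indep, h𝒱.span⟩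
  let := hint.chooseDecomposition
  refine ⟨fun h => (𝒱 h).subtype ∘ₗ DirectSum.component F G (fun h => 𝒱 h) h ∘ₗ
    (DirectSum.decomposeLinearEquiv 𝒱).toLinearMap, ?_, ?_, ?_, ?_⟩
  · intro h v
    exact Subtype.prop _
  · intro h v hv
    exact DirectSum.decompose_of_mem_same 𝒱 hv
  · intro h k hk v hv
    exact DirectSum.decompose_of_mem_ne 𝒱 hv hk
  · intro W v hv
    rw [← DirectSum.sum_support_decompose 𝒱 v]
    exact W.sum_mem fun h _ => hv h

/-- The form in which gradedness is checked below; the hypotheses on `p` are those supplied by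
`IsVectorGrading.exists_proj`. -/
theorem isGradedSubspace_iff {V : Type*} [AddCommGroup V] [Module F V]
    {𝒱 : G → Submodule F V} {p : G → V →ₗ[F] V} (hp : ∀ h v, p h v ∈ 𝒱 h)
    (hp₁ : ∀ h, ∀ v ∈ 𝒱 h, p h v = v) (hp₀ : ∀ h k, k ≠ h → ∀ v ∈ 𝒱 k, p h v = 0)
    (hp₂ : ∀ W : Submodule F V, ∀ v, (∀ h, p h v ∈ W) → v ∈ W) (W : Submodule F V) :
    IsGradedSubspace 𝒱 W ↔ ∀ v ∈ W, ∀ h, p h v ∈ W := by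
  constructor
  · intro hW v hv h
    have hle : (⨆ k, W ⊓ 𝒱 k) ≤ W.comap (p h) := by
      refine iSup_le fun k x hx => ?_
      rw [Submodule.mem_comap]
      by_cases hk : k = h
      · subst hk
        rw [hp₁ k x hx.2]
        exact hx.1
      · rw [hp₀ h k hk x hx.2]
        exact W.zero_mem
    rw [IsGradedSubspace] at hW
    rw [hW] at hv
    exact hle hv
  · intro hW
    refine le_antisymm (fun v hv => ?_) (iSup_le fun h => inf_le_left)
    exact hp₂ _ v fun h => Submodule.mem_iSup_of_mem h ⟨hW v hv h, hp h v⟩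

variable [Group G]

/-- A linear map homogeneous of degree `k` on the right commutes with taking components. -/
theorem proj_comm_of_mapsTo {V V' : Type*} [AddCommGroup V] [Module F V]
    [AddCommGroup V'] [Module F V'] {𝒱 : G → Submodule F V} (h𝒱 : IsVectorGrading 𝒱)
    {𝒱' : G → Submodule F V'} {p : G → V →ₗ[F] V} {p' : G → V' →ₗ[F] V'}
    (hp₁ : ∀ h, ∀ v ∈ 𝒱 h, p h v = v) (hp₀ : ∀ h k, k ≠ h → ∀ v ∈ 𝒱 k, p h v = 0)
    (hp₁' : ∀ h, ∀ v ∈ 𝒱' h, p' h v = v) (hp₀' : ∀ h k, k ≠ h → ∀ v ∈ 𝒱' k, p' h v = 0)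
    (k : G) (T : V →ₗ[F] V') (hT : ∀ h, ∀ v ∈ 𝒱 h, T v ∈ 𝒱' (h * k)) (h : G) (v : V) :
    p' (h * k) (T v) = T (p h v) := by
  have hle : (⨆ h, 𝒱 h) ≤ LinearMap.eqLocus (p' (h * k) ∘ₗ T) (T ∘ₗ p h) := by
    refine iSup_le fun l x hx => ?_
    rw [LinearMap.mem_eqLocus, LinearMap.comp_apply, LinearMap.comp_apply]
    by_cases hl : l = h
    · subst hl
      rw [hp₁ l x hx, hp₁' _ _ (hT l x hx)]
    · rw [hp₀ h l hl x hx, map_zero]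
      exact hp₀' _ _ (fun e => hl (mul_right_cancel e)) _ (hT l x hx)
  exact hle (h𝒱.span ▸ Submodule.mem_top : v ∈ ⨆ h, 𝒱 h)

end Gradings

/-! ### The graded Jacobson radical: what it contains and what it avoids -/

section Radical

variable {F : Type u} [Field F] {G : Type w} [Group G]

theorem mul_mem_gradedJacobson {A : Type v} [NonUnitalRing A] [Module F A]
    {𝒜 : G → Submodule F A} {a : A} (ha : a ∈ gradedJacobson 𝒜) (b : A) :
    a * b ∈ gradedJacobson 𝒜 := by
  intro M _ _ act ℳ hM m
  rw [hM.act_mul, ha M act ℳ hM m, map_zero, LinearMap.zero_apply]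

theorem mul_mem_gradedJacobson' {A : Type v} [NonUnitalRing A] [Module F A]
    {𝒜 : G → Submodule F A} {a : A} (ha : a ∈ gradedJacobson 𝒜) (b : A) :
    b * a ∈ gradedJacobson 𝒜 := by
  intro M _ _ act ℳ hM m
  rw [hM.act_mul]
  exact ha M act ℳ hM _

/-- A homogeneous left ideal of square zero lies in the graded Jacobson radical. -/
theorem le_gradedJacobson_of_mul_eq_zero {A : Type v} [NonUnitalRing A] [Module F A]
    {𝒜 : G → Submodule F A} {k : G} {T : Submodule F A} (hT : T ≤ 𝒜 k)
    (hmul : ∀ (a : A), ∀ t ∈ T, a * t ∈ T) (hsq : ∀ s ∈ T, ∀ t ∈ T, s * t = 0) :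
    T ≤ gradedJacobson 𝒜 := by
  intro t ht M _ _ act ℳ hM m
  obtain ⟨p, hp, hp₁, hp₀, hp₂⟩ := hM.toIsVectorGrading.exists_proj
  -- The annihilator of `T` in `M` is a submodule because `T` is a left ideal, and graded because
  -- `T` is homogeneous. It contains `M T` as `T` has square zero, so `m t = 0` whether it is `⊥` or
  -- `⊤`.
  let N : Submodule F M :=
    { carrier := {m | ∀ t ∈ T, act m t = 0}
      zero_mem' := fun t _ => by simp
      add_mem' := fun ha hb t ht => by simp [ha t ht, hb t ht]
      smul_mem' := fun c m hm t ht => by simp [hm t ht] }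
  have hgr : IsGradedSubspace ℳ N := by
    rw [isGradedSubspace_iff hp hp₁ hp₀ hp₂]
    intro m hm h t ht
    have := proj_comm_of_mapsTo hM.toIsVectorGrading hp₁ hp₀ hp₁ hp₀ k (act.flip t)
      (fun h v hv => hM.act_mem h k v hv t (hT ht)) h m
    rw [LinearMap.flip_apply, LinearMap.flip_apply, hm t ht, map_zero] at this
    exact this.symm
  have hsub : ∀ m ∈ N, ∀ a : A, act m a ∈ N := fun m hm a t ht => by
    rw [← hM.act_mul]
    exact hm _ (hmul a t ht)
  have hN : act m t ∈ N := fun s hs => by rw [← hM.act_mul, hsq t ht s hs, map_zero]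
  rcases hM.eq_bot_or_eq_top N hgr hsub with h | h
  · rw [h] at hN
    exact (Submodule.mem_bot F).1 hN
  · have : m ∈ N := h ▸ Submodule.mem_top
    exact this t ht

/-- A nonzero idempotent of degree `1` is not in the graded Jacobson radical. -/
theorem notMem_gradedJacobson_of_idempotent {A : Type v} [NonUnitalRing A] [Module F A]
    [IsScalarTower F A A] [SMulCommClass F A A] [FiniteDimensional F A]
    {𝒜 : G → Submodule F A} (h𝒜 : IsAlgebraGrading 𝒜) {e : A} (he : e ∈ 𝒜 1) (hee : e * e = e)
    (he0 : e ≠ 0) : e ∉ gradedJacobson 𝒜 := by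
  obtain ⟨p, hp, hp₁, hp₀, hp₂⟩ := h𝒜.toIsVectorGrading.exists_proj
  have hcomp := isGradedSubspace_iff hp hp₁ hp₀ hp₂
  -- Proper graded right ideals modulo which `e` is a left unit. The set contains the right
  -- annihilator of `e`, and for a maximal member `N` the quotient `A ⧸ N` is graded simple.
  let P : Set (Submodule F A) := {N | IsGradedSubspace 𝒜 N ∧ (∀ n ∈ N, ∀ a, n * a ∈ N) ∧
    e ∉ N ∧ ∀ a, a - e * a ∈ N}
  have hP : P.Nonempty := by
    refine ⟨LinearMap.ker (LinearMap.mulLeft F e), ?_, ?_, ?_, ?_⟩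
    · rw [hcomp]
      intro v hv h
      have := proj_comm_of_mapsTo h𝒜.toIsVectorGrading hp₁ hp₀ hp₁ hp₀ 1 (LinearMap.mulLeft F e)
        (fun h v hv => by simpa using h𝒜.mul_mem 1 h e he v hv) h v
      rw [LinearMap.mem_ker] at hv ⊢
      rw [← this, hv, map_zero]
    · intro n hn a
      simp only [LinearMap.mem_ker, LinearMap.mulLeft_apply] at hn ⊢
      rw [← mul_assoc, hn, zero_mul]
    · simpa [hee] using he0
    · intro a
      simp [mul_sub, ← mul_assoc, hee]
  obtain ⟨N, ⟨hNg, hNr, hNe, hN1⟩, hmax⟩ := WellFounded.has_min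
    (wellFounded_gt : WellFounded ((· > ·) : Submodule F A → Submodule F A → Prop)) P hP
  rw [hcomp] at hNg
  intro heJ
  let act : (A ⧸ N) →ₗ[F] A →ₗ[F] (A ⧸ N) :=
    (LinearMap.flip (LinearMap.mk₂ F (fun (a : A) (m : A ⧸ N) =>
        N.mapQ N (LinearMap.mulRight F a) (fun n hn => hNr n hn a) m)
      (fun a b m => by
        obtain ⟨m, rfl⟩ := N.mkQ_surjective m
        exact congrArg N.mkQ (mul_add m a b))
      (fun c a m => by
        obtain ⟨m, rfl⟩ := N.mkQ_surjective m
        exact congrArg N.mkQ (mul_smul_comm c m a))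
      (fun a m n => map_add _ _ _)
      (fun c a m => map_smul _ _ _)))
  have hact : ∀ m a : A, act (N.mkQ m) a = N.mkQ (m * a) := fun m a => rfl
  let ℳ : G → Submodule F (A ⧸ N) := fun h => (𝒜 h).map N.mkQ
  let p' : G → (A ⧸ N) →ₗ[F] (A ⧸ N) := fun h => N.mapQ N (p h) fun n hn => hNg n hn h
  have hp' : ∀ h a, p' h (N.mkQ a) = N.mkQ (p h a) := fun h a => rfl
  have hM : IsGradedSimpleRightModule 𝒜 act ℳ := by
    refine { indep := ?_, span := ?_, act_mul := ?_, act_mem := ?_, act_ne_zero := ?_,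
             eq_bot_or_eq_top := ?_ }
    · refine iSupIndep_of_proj p' ?_ ?_
      · rintro h _ ⟨v, hv, rfl⟩
        rw [hp', hp₁ h v hv]
      · rintro h k hk _ ⟨v, hv, rfl⟩
        rw [hp', hp₀ h k hk v hv, map_zero]
    · rw [← Submodule.map_iSup, h𝒜.span, Submodule.map_top, Submodule.range_mkQ]
    · intro m a b
      obtain ⟨m, rfl⟩ := N.mkQ_surjective m
      rw [hact, hact, hact, mul_assoc]
    · rintro h k _ ⟨m, hm, rfl⟩ a ha
      exact ⟨m * a, h𝒜.mul_mem h k m hm a ha, rfl⟩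
    · refine ⟨N.mkQ e, e, fun h => hNe ?_⟩
      rwa [hact, hee, Submodule.mkQ_apply, Submodule.Quotient.mk_eq_zero] at h
    · intro K hK hKr
      have hle : N ≤ K.comap N.mkQ := fun n hn => by
        rw [Submodule.mem_comap, Submodule.mkQ_apply, (Submodule.Quotient.mk_eq_zero N).2 hn]
        exact K.zero_mem
      have hKg : IsGradedSubspace 𝒜 (K.comap N.mkQ) := by
        rw [hcomp]
        intro v hv h
        rw [Submodule.mem_comap] at hv ⊢
        rw [← hp']
        have hle : (⨆ k, K ⊓ ℳ k) ≤ K.comap (p' h) := by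
          refine iSup_le fun k x hx => ?_
          obtain ⟨hxK, y, hy, rfl⟩ := hx
          rw [Submodule.mem_comap, hp']
          by_cases hk : k = h
          · subst hk
            rwa [hp₁ k y hy]
          · rw [hp₀ h k hk y hy, map_zero]
            exact K.zero_mem
        rw [IsGradedSubspace] at hK
        rw [hK] at hv
        exact hle hv
      -- A submodule containing the class of `e` is everything, since `m ≡ e m` modulo `N`;
      -- otherwise its preimage belongs to `P` and equals `N` by maximality.
      by_cases heK : e ∈ K.comap N.mkQ
      · right
        rw [eq_top_iff]
        intro m _
        obtain ⟨m, rfl⟩ := N.mkQ_surjective m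
        have h1 : N.mkQ (e * m) ∈ K := by
          rw [← hact]
          exact hKr _ heK m
        have h2 : N.mkQ (m - e * m) ∈ K := hle (hN1 m)
        have := K.add_mem h2 h1
        rwa [← map_add, sub_add_cancel] at this
      · left
        have hKP : K.comap N.mkQ ∈ P := by
          refine ⟨hKg, fun n hn a => ?_, heK, fun a => hle (hN1 a)⟩
          rw [Submodule.mem_comap, ← hact]
          exact hKr _ hn a
        have : N = K.comap N.mkQ := by
          by_contra hne
          exact hmax _ hKP (lt_of_le_of_ne hle hne)
        rw [eq_bot_iff]
        intro m hm
        obtain ⟨m, rfl⟩ := N.mkQ_surjective m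
        have : m ∈ N := by
          rw [this]
          exact hm
        rw [Submodule.mem_bot, Submodule.mkQ_apply, Submodule.Quotient.mk_eq_zero]
        exact this
  have := heJ (A ⧸ N) act ℳ hM (N.mkQ e)
  rw [hact, hee, Submodule.mkQ_apply, Submodule.Quotient.mk_eq_zero] at this
  exact hNe this

end Radical

/-! ### Polynomial functions on a finite field -/

section FiniteField

variable {F : Type u} [Field F] [Finite F]

open Polynomial

/-- If `y ^ q = y`, then polynomials that agree as functions on `F` agree at `y`. -/
theorem aeval_eq_of_eval_eq {R : Type*} [Ring R] [Algebra F R] {y : R}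
    (hy : y ^ Nat.card F = y) {P Q : F[X]} (h : ∀ c, P.eval c = Q.eval c) :
    aeval y P = aeval y Q := by
  classical
  have := Fintype.ofFinite F
  -- `X ^ q - X` is the product of the coprime factors `X - c`, each of which divides `P - Q`.
  have hdvd : (X ^ Fintype.card F - X : F[X]) ∣ P - Q := by
    have hdeg := FiniteField.X_pow_card_sub_X_natDegree_eq F (Fintype.one_lt_card (α := F))
    have hmonic : (X ^ Fintype.card F - X : F[X]).Monic :=
      monic_X_pow_sub (by rw [degree_X]; exact_mod_cast Fintype.one_lt_card)
    have hprod : ∏ c : F, (X - C c) = X ^ Fintype.card F - X := by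
      have := prod_multiset_X_sub_C_of_monic_of_roots_card_eq hmonic
        (by rw [FiniteField.roots_X_pow_card_sub_X, hdeg]; rfl)
      rwa [FiniteField.roots_X_pow_card_sub_X] at this
    rw [← hprod]
    refine Finset.prod_dvd_of_coprime (fun a _ b _ hab => ?_) fun a _ => ?_
    · exact pairwise_coprime_X_sub_C (s := (id : F → F)) Function.injective_id hab
    · rw [dvd_iff_isRoot, IsRoot, eval_sub, h, sub_self]
  obtain ⟨D, hD⟩ := hdvd
  rw [← sub_eq_zero, ← map_sub, hD, map_mul, map_sub, map_pow, aeval_X,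
    ← Nat.card_eq_fintype_card, hy, sub_self, zero_mul]

end FiniteField

/-! ### The component of degree 1: reduced, commutative, split by primitive idempotents -/

section Idempotents

variable {F : Type u} [Field F] {A : Type v} [NonUnitalRing A] [Module F A]
  [SMulCommClass F A A]

/-- As `q ≥ 2`, the power `y ^ q = y` is divisible by `y ^ 2`. -/
theorem eq_zero_of_mul_self_eq_zero [Finite F] [IsScalarTower F A A] {y : A}
    (hy : (Unitization.inr y : Unitization F A) ^ Nat.card F = Unitization.inr y)
    (h : y * y = 0) : y = 0 := by
  have hq : 2 ≤ Nat.card F := Finite.one_lt_card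
  obtain ⟨n, hn⟩ := Nat.exists_eq_add_of_le hq
  have h2 : (Unitization.inr y : Unitization F A) ^ 2 = 0 := by
    rw [pow_two, ← Unitization.inr_mul, h, Unitization.inr_zero]
  rw [hn, pow_add, h2, zero_mul] at hy
  exact (Unitization.inr_injective (R := F) ((Unitization.inr_zero F).trans hy)).symm

open Polynomial in
/-- Polynomials without constant term can be evaluated in a non-unital subalgebra. -/
theorem exists_inr_eq_aeval [IsScalarTower F A A] {Y : Submodule F A}
    (hY : ∀ a ∈ Y, ∀ b ∈ Y, a * b ∈ Y) {y : A}
    (hy : y ∈ Y) {P : F[X]} (hP : P.eval 0 = 0) :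
    ∃ z ∈ Y, (Unitization.inr z : Unitization F A) = aeval (Unitization.inr y) P := by
  obtain ⟨Q, rfl⟩ : X ∣ P := by rwa [X_dvd_iff, coeff_zero_eq_eval_zero]
  clear hP
  induction Q using Polynomial.induction_on' with
  | add Q₁ Q₂ h₁ h₂ =>
    obtain ⟨z₁, hz₁, e₁⟩ := h₁
    obtain ⟨z₂, hz₂, e₂⟩ := h₂
    exact ⟨z₁ + z₂, Y.add_mem hz₁ hz₂, by rw [mul_add, map_add, ← e₁, ← e₂, Unitization.inr_add]⟩
  | monomial n c =>
    induction n with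
    | zero =>
      exact ⟨c • y, Y.smul_mem c hy, by
        rw [Unitization.inr_smul, monomial_zero_left, map_mul, aeval_X, aeval_C,
          ← Algebra.commutes, Algebra.smul_def]⟩
    | succ n ih =>
      obtain ⟨z, hz, e⟩ := ih
      refine ⟨z * y, hY z hz y hy, ?_⟩
      rw [Unitization.inr_mul, e, ← monomial_mul_X, ← mul_assoc, map_mul _ _ X, aeval_X]

-- Lagrange interpolation: `y = ∑ c • ε_c(y)`, where `ε_c` is the polynomial indicator function of
-- `c ∈ F`. Each `ε_c(y)` is idempotent because `y ^ q = y` lets polynomials be compared as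
-- functions on `F`.
open Polynomial in
theorem mem_span_idempotents [Finite F] [IsScalarTower F A A] {Y : Submodule F A}
    (hY : ∀ a ∈ Y, ∀ b ∈ Y, a * b ∈ Y)
    (hpow : ∀ y ∈ Y, (Unitization.inr y : Unitization F A) ^ Nat.card F = Unitization.inr y)
    {y : A} (hy : y ∈ Y) : y ∈ Submodule.span F {e | e ∈ Y ∧ e * e = e} := by
  classical
  have := Fintype.ofFinite F
  let ε : F → F[X] := fun c => 1 - (X - C c) ^ (Fintype.card F - 1)
  have hε : ∀ c d, (ε c).eval d = if d = c then 1 else 0 := by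
    intro c d
    have hq : Fintype.card F - 1 ≠ 0 := by
      have := Fintype.one_lt_card (α := F)
      omega
    split_ifs with h
    · simp [ε, h, hq]
    · simp [ε, FiniteField.pow_card_sub_one_eq_one (d - c) (sub_ne_zero.2 h)]
  have hex : ∀ c, ∃ z ∈ Submodule.span F {e | e ∈ Y ∧ e * e = e},
      (Unitization.inr z : Unitization F A) = aeval (Unitization.inr y) (C c * ε c) := by
    intro c
    -- `ε 0` has constant term 1 and its value need not lie in `Y`, but its coefficient is 0.
    by_cases hc : c = 0
    · exact ⟨0, Submodule.zero_mem _, by simp [hc]⟩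
    · obtain ⟨z, hz, e⟩ := exists_inr_eq_aeval hY hy (P := ε c)
        (by rw [hε, if_neg (Ne.symm hc)])
      refine ⟨c • z, Submodule.smul_mem _ _ (Submodule.subset_span ⟨hz, ?_⟩), ?_⟩
      · refine Unitization.inr_injective (R := F) ?_
        rw [Unitization.inr_mul, e, ← map_mul]
        refine aeval_eq_of_eval_eq (hpow y hy) fun d => ?_
        rw [eval_mul, hε]
        split_ifs <;> simp
      · rw [Unitization.inr_smul, e, map_mul, aeval_C, Algebra.smul_def]
  choose z hz e using hex
  have : y = ∑ c, z c := by
    refine Unitization.inr_injective (R := F) ?_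
    have h1 : (Unitization.inr (∑ c, z c) : Unitization F A) = ∑ c, Unitization.inr (z c) :=
      map_sum (Unitization.inrHom F F A) z Finset.univ
    rw [h1, Finset.sum_congr rfl fun c _ => e c, ← map_sum]
    conv_lhs => rw [← aeval_X (R := F) (Unitization.inr y : Unitization F A)]
    refine aeval_eq_of_eval_eq (hpow y hy) fun d => ?_
    simp [eval_finsetSum, hε]
  rw [this]
  exact Submodule.sum_mem _ fun c _ => hz c

/-- A family of orthogonal idempotents `e` spanning `Y`, with `e Y = F e`. -/
structure IsPrimitiveFamily (Y : Submodule F A) (S : Finset A) : Prop where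
  mem : ∀ e ∈ S, e ∈ Y
  ne_zero : ∀ e ∈ S, e ≠ 0
  idem : ∀ e ∈ S, e * e = e
  orth : ∀ e ∈ S, ∀ f ∈ S, e ≠ f → e * f = 0
  scal : ∀ e ∈ S, ∀ y ∈ Y, ∃ c : F, e * y = c • e
  sum_mul : ∀ y ∈ Y, ∑ e ∈ S, e * y = y

/-- Idempotents of a reduced ring are central: `eb - ebe` and `be - ebe` have square zero. -/
theorem commute_of_reduced [IsScalarTower F A A] {Y : Submodule F A}
    (hY : ∀ a ∈ Y, ∀ b ∈ Y, a * b ∈ Y)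
    (hred : ∀ y ∈ Y, y * y = 0 → y = 0)
    (hspan : ∀ y ∈ Y, y ∈ Submodule.span F {e | e ∈ Y ∧ e * e = e}) :
    ∀ a ∈ Y, ∀ b ∈ Y, a * b = b * a := by
  intro a ha b hb
  have hmem := hspan a ha
  clear ha
  induction hmem using Submodule.span_induction with
  | mem e he =>
    obtain ⟨heY, he⟩ := he
    have h1 : e * b - e * b * e = 0 := by
      refine hred _ (Y.sub_mem (hY e heY b hb) (hY _ (hY e heY b hb) e heY)) ?_
      have : (e * b - e * b * e) * e = 0 := by
        rw [sub_mul, mul_assoc (e * b) e e, he, sub_self]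
      calc (e * b - e * b * e) * (e * b - e * b * e)
          = ((e * b - e * b * e) * e) * (b - b * e) := by
            rw [mul_assoc _ e, mul_sub e, mul_assoc e b e]
        _ = 0 := by rw [this, zero_mul]
    have h2 : b * e - e * b * e = 0 := by
      refine hred _ (Y.sub_mem (hY b hb e heY) (hY _ (hY e heY b hb) e heY)) ?_
      have : e * (b * e - e * b * e) = 0 := by
        rw [mul_sub, mul_assoc e b e, ← mul_assoc e e, he, sub_self]
      calc (b * e - e * b * e) * (b * e - e * b * e)
          = (b - e * b) * (e * (b * e - e * b * e)) := by
            rw [← mul_assoc _ e, sub_mul b]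
        _ = 0 := by rw [this, mul_zero]
    rw [sub_eq_zero.1 h1, sub_eq_zero.1 h2]
  | zero => simp
  | add x y _ _ hx hy => rw [add_mul, mul_add, hx, hy]
  | smul c x _ hx => rw [smul_mul_assoc, mul_smul_comm, hx]

/-- The family consists of the atoms of the finite lattice of idempotents of `Y`. For an atom `e`,
every idempotent `f` has `ef = 0` or `ef = e`, which gives orthogonality and scalar action. -/
theorem exists_isPrimitiveFamily [Finite A] {Y : Submodule F A} (hY : ∀ a ∈ Y, ∀ b ∈ Y, a * b ∈ Y)
    (hcomm : ∀ a ∈ Y, ∀ b ∈ Y, a * b = b * a)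
    (hspan : ∀ y ∈ Y, y ∈ Submodule.span F {e | e ∈ Y ∧ e * e = e}) :
    ∃ S : Finset A, IsPrimitiveFamily Y S := by
  classical
  let P : Set A := {e | e ∈ Y ∧ e * e = e ∧ e ≠ 0 ∧
    ∀ f ∈ Y, f * f = f → e * f = f → f = 0 ∨ f = e}
  have hbelow : ∀ f ∈ Y, f * f = f → f ≠ 0 → ∃ e ∈ P, f * e = e := by
    intro f hf hff hf0
    -- An atom below `f` is one whose fixed set `eA` has the fewest elements.
    let Q : Set A := {e | e ∈ Y ∧ e * e = e ∧ e ≠ 0 ∧ f * e = e}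
    obtain ⟨e, ⟨heY, hee, he0, hfe⟩, hmin⟩ := Set.exists_min_image Q
      (fun e => {x | e * x = x}.ncard) (Set.toFinite Q) ⟨f, hf, hff, hf0, hff⟩
    refine ⟨e, ⟨heY, hee, he0, fun e' he' hee' h => ?_⟩, hfe⟩
    by_contra! hne
    have hle := hmin e' ⟨he', hee', hne.1, by rw [← h, ← mul_assoc, hfe]⟩
    have hlt : {x | e' * x = x} ⊂ {x | e * x = x} := by
      refine (Set.ssubset_iff_of_subset fun x hx => ?_).2 ⟨e, hee, fun hx => ?_⟩
      · have hx : e' * x = x := hx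
        show e * x = x
        rw [← hx, ← mul_assoc, h]
      · have hx : e' * e = e := hx
        rw [hcomm e' he' e heY, h] at hx
        exact hne.2 hx
    exact absurd (Set.ncard_lt_ncard hlt) (not_lt.2 hle)
  have hmul : ∀ e ∈ P, ∀ f ∈ Y, f * f = f → e * f = 0 ∨ e * f = e := by
    rintro e ⟨heY, hee, -, hprim⟩ f hf hff
    refine hprim (e * f) (hY e heY f hf) ?_ (by rw [← mul_assoc, hee])
    rw [mul_assoc, ← mul_assoc f e f, hcomm f hf e heY, mul_assoc e f f, hff, ← mul_assoc, hee]
  have horth : ∀ e ∈ P, ∀ f ∈ P, e ≠ f → e * f = 0 := by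
    intro e he f hf hne
    rcases hmul e he f hf.1 hf.2.1 with h | h
    · exact h
    rcases hmul f hf e he.1 he.2.1 with h' | h'
    · rw [hcomm e he.1 f hf.1, h']
    · rw [hcomm e he.1 f hf.1, h'] at h
      exact absurd h.symm hne
  have hmem : ∀ e, e ∈ (Set.toFinite P).toFinset ↔ e ∈ P := fun e => Set.Finite.mem_toFinset _
  refine ⟨(Set.toFinite P).toFinset, fun e he => ((hmem e).1 he).1,
    fun e he => ((hmem e).1 he).2.2.1, fun e he => ((hmem e).1 he).2.1,
    fun e he f hf => horth e ((hmem e).1 he) f ((hmem f).1 hf), ?_, ?_⟩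
  · intro e he y hy
    rw [hmem] at he
    have := hspan y hy
    clear hy
    induction this using Submodule.span_induction with
    | mem f hf =>
      rcases hmul e he f hf.1 hf.2 with h | h
      · exact ⟨0, by rw [h, zero_smul]⟩
      · exact ⟨1, by rw [h, one_smul]⟩
    | zero => exact ⟨0, by simp⟩
    | add x y _ _ hx hy =>
      obtain ⟨c, hc⟩ := hx
      obtain ⟨d, hd⟩ := hy
      exact ⟨c + d, by rw [mul_add, hc, hd, add_smul]⟩
    | smul a x _ hx =>
      obtain ⟨c, hc⟩ := hx
      exact ⟨a * c, by rw [mul_smul_comm, hc, mul_smul]⟩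
  · intro y hy
    have := hspan y hy
    clear hy
    induction this using Submodule.span_induction with
    | mem f hf =>
      obtain ⟨hfY, hff⟩ := hf
      set s := ∑ e ∈ (Set.toFinite P).toFinset, e * f with hs
      have hes : ∀ e ∈ P, e * s = e * f := by
        intro e he
        rw [hs, Finset.mul_sum, Finset.sum_eq_single e]
        · rw [← mul_assoc, he.2.1]
        · intro e' he' hne
          rw [← mul_assoc, horth e he e' ((hmem e').1 he') hne.symm, zero_mul]
        · intro h
          exact absurd ((hmem e).2 he) h
      have hsY : s ∈ Y := Y.sum_mem fun e he => hY e ((hmem e).1 he).1 f hfY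
      have hsf : s * f = s := by
        rw [hs, Finset.sum_mul]
        exact Finset.sum_congr rfl fun e _ => by rw [mul_assoc, hff]
      have hss : s * s = s := by
        conv_lhs => rw [hs, Finset.sum_mul]
        rw [hs]
        refine Finset.sum_congr rfl fun e he => ?_
        rw [mul_assoc, ← hs, hcomm f hfY s hsY, hsf, hes e ((hmem e).1 he)]
      -- If `f - s` were nonzero, an atom `e` would lie below this idempotent, yet `e (f - s) = 0`.
      by_contra hne
      obtain ⟨e, he, h⟩ := hbelow (f - s) (Y.sub_mem hfY hsY)
        (by rw [sub_mul, mul_sub, mul_sub, hff, hss, hsf, hcomm f hfY s hsY, hsf]; abel)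
        (fun h => hne (sub_eq_zero.1 h).symm)
      rw [hcomm _ (Y.sub_mem hfY hsY) e he.1, mul_sub, hes e he, sub_self] at h
      exact he.2.2.1 h.symm
    | zero => simp
    | add x y _ _ hx hy => simp only [mul_add, Finset.sum_add_distrib, hx, hy]
    | smul a x _ hx => simp only [mul_smul_comm, ← Finset.smul_sum, hx]

end Idempotents

/-! ### The simple blocks F and M₂(F) -/

section Blocks

variable {F : Type u} [Field F] {G : Type w} [Group G]

theorem isVectorGrading_trivialGrading : IsVectorGrading (trivialGrading F G) := by
  classical
  refine ⟨iSupIndep_of_proj (fun h => if h = 1 then LinearMap.id else 0) ?_ ?_, ?_⟩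
  · intro h v hv
    split_ifs with h1
    · rfl
    · exact (hv h1).symm
  · intro h k hk v hv
    split_ifs with h1
    · exact hv (h1 ▸ hk)
    · rfl
  · exact eq_top_iff.2 fun v _ => Submodule.mem_iSup_of_mem 1 fun h => absurd rfl h

theorem isVectorGrading_matrixGrading (g : G) :
    IsVectorGrading (matrixGrading F g) := by
  classical
  let p : G → Matrix (Fin 2) (Fin 2) F →ₗ[F] Matrix (Fin 2) (Fin 2) F := fun h =>
    { toFun := fun m => !![if h = 1 then m 0 0 else 0, if h = g then m 0 1 else 0;
        if h = g⁻¹ then m 1 0 else 0, if h = 1 then m 1 1 else 0]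
      map_add' := fun m n => by
        ext i j
        fin_cases i <;> fin_cases j <;> simp <;> split_ifs <;> simp
      map_smul' := fun c m => by
        ext i j
        fin_cases i <;> fin_cases j <;> simp }
  refine ⟨iSupIndep_of_proj p ?_ ?_, ?_⟩
  · intro h m hm
    ext i j
    fin_cases i <;> fin_cases j <;> simp only [p, LinearMap.coe_mk, AddHom.coe_mk] <;> simp
    · exact fun h1 => (hm.1 h1).1.symm
    · exact fun h1 => (hm.2.1 h1).symm
    · exact fun h1 => (hm.2.2 h1).symm
    · exact fun h1 => (hm.1 h1).2.symm
  · intro h k hk m hm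
    ext i j
    fin_cases i <;> fin_cases j <;> simp only [p, LinearMap.coe_mk, AddHom.coe_mk] <;> simp
    · exact fun h1 => (hm.1 (h1 ▸ hk)).1
    · exact fun h1 => hm.2.1 (h1 ▸ hk)
    · exact fun h1 => hm.2.2 (h1 ▸ hk)
    · exact fun h1 => (hm.1 (h1 ▸ hk)).2
  · refine eq_top_iff.2 fun m _ => ?_
    have hm : m = !![m 0 0, 0; 0, m 1 1] + !![0, m 0 1; 0, 0] + !![0, 0; m 1 0, 0] := by
      ext i j
      fin_cases i <;> fin_cases j <;> simp
    rw [hm]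
    refine Submodule.add_mem _ (Submodule.add_mem _ ?_ ?_) ?_
    · exact Submodule.mem_iSup_of_mem 1 ⟨fun h => absurd rfl h, fun _ => rfl, fun _ => rfl⟩
    · exact Submodule.mem_iSup_of_mem g ⟨fun _ => ⟨rfl, rfl⟩, fun h => absurd rfl h, fun _ => rfl⟩
    · exact Submodule.mem_iSup_of_mem g⁻¹
        ⟨fun _ => ⟨rfl, rfl⟩, fun _ => rfl, fun h => absurd rfl h⟩

variable {A : Type v} [NonUnitalRing A] [Module F A]

/-- The range of an injective graded homomorphism is a graded subalgebra isomorphic to its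
source. -/
theorem range_graded_of_injective {𝒜 : G → Submodule F A} (h𝒜 : IsVectorGrading 𝒜)
    {R : Type*} [NonUnitalRing R] [Module F R] {ℛ : G → Submodule F R} (hℛ : IsVectorGrading ℛ)
    (φ : R →ₙₐ[F] A) (hφ : Function.Injective φ) (hdeg : ∀ h, ∀ r ∈ ℛ h, φ r ∈ 𝒜 h) :
    IsGradedSubspace 𝒜 (NonUnitalAlgHom.range φ).toSubmodule ∧
      GradedIsomorphic (subalgebraGrading 𝒜 (NonUnitalAlgHom.range φ)) ℛ := by
  obtain ⟨p, hp, hp₁, hp₀, hp₂⟩ := h𝒜.exists_proj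
  obtain ⟨r, hr, hr₁, hr₀, -⟩ := hℛ.exists_proj
  have hcomm : ∀ h v, p h (φ v) = φ (r h v) := fun h v => by
    have := proj_comm_of_mapsTo hℛ hr₁ hr₀ hp₁ hp₀ 1 (φ : R →ₗ[F] A)
      (fun h v hv => by simpa using hdeg h v hv) h v
    simpa using this
  constructor
  · rw [isGradedSubspace_iff hp hp₁ hp₀ hp₂]
    rintro _ ⟨v, rfl⟩ h
    exact ⟨r h v, (hcomm h v).symm⟩
  · have hex : ∀ x : NonUnitalAlgHom.range φ, ∃ v, φ v = x := fun x => x.2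
    choose ψ hψ using hex
    refine ⟨{ toFun := ψ
              map_smul' := fun c x => hφ ?_
              map_zero' := hφ ?_
              map_add' := fun x y => hφ ?_
              map_mul' := fun x y => hφ ?_ }, ⟨fun x y hxy => ?_, fun v => ?_⟩, ?_⟩
    · rw [hψ, MonoidHom.id_apply, map_smul, hψ]; rfl
    · rw [hψ, map_zero]; rfl
    · rw [hψ, map_add, hψ, hψ]; rfl
    · rw [hψ, map_mul, hψ, hψ]; rfl
    · have hxy : ψ x = ψ y := hxy
      exact Subtype.ext (by rw [← hψ x, ← hψ y, hxy])
    · exact ⟨⟨φ v, v, rfl⟩, hφ (hψ _)⟩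
    · intro h x hx
      have hx : (x : A) ∈ 𝒜 h := hx
      have : r h (ψ x) = ψ x := hφ (by rw [← hcomm, hψ, hp₁ h _ hx])
      show ψ x ∈ ℛ h
      rw [← this]
      exact hr h _

/-- `C` is a graded subalgebra with unit `f`, isomorphic to `F` or to the graded `M₂(F)`, that
meets no two-sided ideal without nonzero elements of degree `1`. -/
structure IsBlock (𝒜 : G → Submodule F A) (g : G) (C : NonUnitalSubalgebra F A) (f : A) :
    Prop where
  graded : IsGradedSubspace 𝒜 C.toSubmodule
  one_mul : ∀ x ∈ C, f * x = x
  mul_one : ∀ x ∈ C, x * f = x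
  iso : GradedIsomorphic (subalgebraGrading 𝒜 C) (trivialGrading F G) ∨
    GradedIsomorphic (subalgebraGrading 𝒜 C) (matrixGrading F g)
  eq_zero_of_mem_ideal : ∀ K : Submodule F A, (∀ x ∈ K, ∀ a, x * a ∈ K ∧ a * x ∈ K) →
    (∀ y ∈ K, y ∈ 𝒜 1 → y = 0) → ∀ x ∈ C, x ∈ K → x = 0

/-- The homogeneous elements `a` and `b` form, with the idempotents `e = ab` and `f = ba`,
a system of matrix units. -/
structure IsMatched (Z W : Submodule F A) (e f a b : A) : Prop where
  mem_left : a ∈ Z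
  mem_right : b ∈ W
  mul_eq : a * b = e
  mul_eq' : b * a = f
  e_mul : e * a = a
  mul_f : a * f = a
  f_mul : f * b = b
  mul_e : b * e = b

theorem IsMatched.symm {Z W : Submodule F A} {e f a b : A} (h : IsMatched Z W e f a b) :
    IsMatched W Z f e b a :=
  ⟨h.mem_right, h.mem_left, h.mul_eq', h.mul_eq, h.f_mul, h.mul_e, h.e_mul, h.mul_f⟩

variable [IsScalarTower F A A] [SMulCommClass F A A]

theorem exists_isBlock_of_idempotent {𝒜 : G → Submodule F A} (h𝒜 : IsVectorGrading 𝒜) (g : G)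
    {e : A} (he : e ∈ 𝒜 1) (hee : e * e = e) (he0 : e ≠ 0) :
    ∃ C : NonUnitalSubalgebra F A, IsBlock 𝒜 g C e ∧ e ∈ C := by
  let φ : F →ₙₐ[F] A :=
    { toFun := fun c => c • e
      map_smul' := fun c d => mul_smul c d e
      map_zero' := zero_smul F e
      map_add' := fun c d => add_smul c d e
      map_mul' := fun c d => by rw [smul_mul_smul_comm, hee] }
  have hφ : Function.Injective φ := smul_left_injective F he0
  have hdeg : ∀ h, ∀ r ∈ trivialGrading F G h, φ r ∈ 𝒜 h := by
    intro h r hr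
    by_cases h1 : h = 1
    · subst h1
      exact (𝒜 1).smul_mem r he
    · rw [hr h1, map_zero]
      exact (𝒜 h).zero_mem
  obtain ⟨hgr, hiso⟩ := range_graded_of_injective h𝒜 isVectorGrading_trivialGrading φ hφ hdeg
  refine ⟨NonUnitalAlgHom.range φ, ⟨hgr, ?_, ?_, Or.inl hiso, ?_⟩, ⟨1, one_smul F e⟩⟩
  · rintro _ ⟨c, rfl⟩
    show e * (c • e) = c • e
    rw [mul_smul_comm, hee]
  · rintro _ ⟨c, rfl⟩
    show (c • e) * e = c • e
    rw [smul_mul_assoc, hee]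
  · rintro K - hK _ ⟨c, rfl⟩ hx
    exact hK _ hx ((𝒜 1).smul_mem c he)

/-- The matching relations and `ef = fe = 0` force the whole multiplication table of the matrix
units `e, a, b, f`. -/
theorem exists_isBlock_of_isMatched {𝒜 : G → Submodule F A} (h𝒜 : IsVectorGrading 𝒜) {g : G}
    {e f a b : A} (hm : IsMatched (𝒜 g) (𝒜 g⁻¹) e f a b)
    (he : e ∈ 𝒜 1) (hf : f ∈ 𝒜 1) (hee : e * e = e) (hff : f * f = f) (hef : e * f = 0)
    (hfe : f * e = 0) (he0 : e ≠ 0) :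
    ∃ C : NonUnitalSubalgebra F A, IsBlock 𝒜 g C (e + f) ∧ e ∈ C ∧ f ∈ C ∧ a ∈ C ∧ b ∈ C := by
  obtain ⟨ha, hb, hab, hba, hea, haf, hfb, hbe⟩ := hm
  have hae : a * e = 0 := by rw [← haf, mul_assoc, hfe, mul_zero]
  have hfa : f * a = 0 := by rw [← hea, ← mul_assoc, hfe, zero_mul]
  have hbf : b * f = 0 := by rw [← hbe, mul_assoc, hef, mul_zero]
  have heb : e * b = 0 := by rw [← hfb, ← mul_assoc, hef, zero_mul]
  have haa : a * a = 0 := by rw [← hea, ← mul_assoc, hea, hae, zero_mul]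
  have hbb : b * b = 0 := by rw [← hfb, ← mul_assoc, hfb, hbf, zero_mul]
  let φ : Matrix (Fin 2) (Fin 2) F →ₙₐ[F] A :=
    { toFun := fun m => m 0 0 • e + m 0 1 • a + m 1 0 • b + m 1 1 • f
      map_smul' := fun c m => by simp [mul_smul]
      map_zero' := by simp
      map_add' := fun m n => by simp only [Matrix.add_apply, add_smul]; abel
      map_mul' := fun m n => by
        simp only [Matrix.mul_apply, Fin.sum_univ_two, add_mul, mul_add, smul_mul_smul_comm, hee,
          hff, hef, hfe, hae, hfa, hbf, heb, haa, hbb, hab, hba, hea, haf, hfb, hbe, smul_zero,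
          add_zero, zero_add, add_smul]
        abel }
  have hφ : ∀ m, φ m = m 0 0 • e + m 0 1 • a + m 1 0 • b + m 1 1 • f := fun m => rfl
  have key : ∀ (K : Submodule F A), (∀ x ∈ K, ∀ a, x * a ∈ K ∧ a * x ∈ K) →
      (∀ y ∈ K, y ∈ 𝒜 1 → y = 0) → ∀ m, φ m ∈ K → m = 0 := by
    intro K hK hK1 m hm
    have h0 : ∀ c : F, c • e ∈ K → c = 0 := fun c hc =>
      (smul_eq_zero.1 (hK1 _ hc ((𝒜 1).smul_mem c he))).resolve_right he0
    -- Sandwiching between matrix units moves each of the four entries to a multiple of `e`, which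
    -- has degree 1 and stays in the ideal `K`.
    have h00 : e * (φ m * e) = m 0 0 • e := by
      simp [hφ, mul_add, add_mul, smul_mul_assoc, mul_smul_comm, hee, hae, hbe, hfe, heb]
    have h01 : e * (φ m * b) = m 0 1 • e := by
      simp [hφ, mul_add, add_mul, smul_mul_assoc, mul_smul_comm, hee, heb, hab, hbb, hfb]
    have h10 : a * (φ m * e) = m 1 0 • e := by
      simp [hφ, mul_add, add_mul, smul_mul_assoc, mul_smul_comm, hee, hae, hbe, hfe, hab]
    have h11 : a * (φ m * b) = m 1 1 • e := by
      simp [hφ, mul_add, add_mul, smul_mul_assoc, mul_smul_comm, heb, hab, hbb, hfb, hae]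
    have hmul : ∀ s t, s * (φ m * t) ∈ K := fun s t => (hK _ (hK _ hm t).1 s).2
    ext i j
    fin_cases i <;> fin_cases j
    · exact h0 _ (h00 ▸ hmul e e)
    · exact h0 _ (h01 ▸ hmul e b)
    · exact h0 _ (h10 ▸ hmul a e)
    · exact h0 _ (h11 ▸ hmul a b)
  have hinj : Function.Injective φ := (injective_iff_map_eq_zero φ).2 fun m hm =>
    key ⊥ (by simp) (by simp) m (by simp [hm])
  have hdeg : ∀ h, ∀ r ∈ matrixGrading F g h, φ r ∈ 𝒜 h := by
    intro h m hm
    have aux : ∀ (k : G) (c : F) (x : A), x ∈ 𝒜 k → (h ≠ k → c = 0) → c • x ∈ 𝒜 h := by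
      intro k c x hx hc
      by_cases hk : h = k
      · subst hk
        exact (𝒜 h).smul_mem c hx
      · rw [hc hk, zero_smul]
        exact (𝒜 h).zero_mem
    exact (𝒜 h).add_mem ((𝒜 h).add_mem ((𝒜 h).add_mem (aux 1 _ e he fun h1 => (hm.1 h1).1)
      (aux g _ a ha hm.2.1)) (aux g⁻¹ _ b hb hm.2.2)) (aux 1 _ f hf fun h1 => (hm.1 h1).2)
  obtain ⟨hgr, hiso⟩ := range_graded_of_injective h𝒜
    (isVectorGrading_matrixGrading g) φ hinj hdeg
  refine ⟨NonUnitalAlgHom.range φ, ⟨hgr, ?_, ?_, Or.inr hiso, ?_⟩, ⟨!![1, 0; 0, 0], ?_⟩,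
    ⟨!![0, 0; 0, 1], ?_⟩, ⟨!![0, 1; 0, 0], ?_⟩, ⟨!![0, 0; 1, 0], ?_⟩⟩
  · rintro _ ⟨m, rfl⟩
    show (e + f) * φ m = φ m
    simp [hφ, mul_add, add_mul, mul_smul_comm, hee, hff, hef, hfe, hfa, heb, hea, hfb]
  · rintro _ ⟨m, rfl⟩
    show φ m * (e + f) = φ m
    simp [hφ, mul_add, add_mul, smul_mul_assoc, hee, hff, hef, hfe, hae, hbf, haf, hbe]
    abel
  · rintro K hK hK1 _ ⟨m, rfl⟩ hx
    have := key K hK hK1 m hx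
    subst this
    exact map_zero φ
  all_goals
    show φ _ = _
    simp [hφ]

end Blocks

/-! ### The partial matching of primitive idempotents -/

section Matching

variable {F : Type u} [Field F] {A : Type v} [NonUnitalRing A] [Module F A]

/-- Multiplication rules of the components of degrees `1`, `g`, `g⁻¹`, with a primitive family of
idempotents for the reduced commutative component `Y` of degree `1`. -/
structure IsTriple (Y Z W : Submodule F A) (S : Finset A) : Prop extends
    IsPrimitiveFamily Y S where
  mul_yy : ∀ a ∈ Y, ∀ b ∈ Y, a * b ∈ Y
  mul_yz : ∀ a ∈ Y, ∀ b ∈ Z, a * b ∈ Z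
  mul_zy : ∀ a ∈ Z, ∀ b ∈ Y, a * b ∈ Z
  mul_yw : ∀ a ∈ Y, ∀ b ∈ W, a * b ∈ W
  mul_wy : ∀ a ∈ W, ∀ b ∈ Y, a * b ∈ W
  mul_zw : ∀ a ∈ Z, ∀ b ∈ W, a * b ∈ Y
  mul_wz : ∀ a ∈ W, ∀ b ∈ Z, a * b ∈ Y
  mul_zz : ∀ a ∈ Z, ∀ b ∈ Z, a * b = 0
  mul_ww : ∀ a ∈ W, ∀ b ∈ W, a * b = 0
  comm : ∀ a ∈ Y, ∀ b ∈ Y, a * b = b * a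
  reduced : ∀ y ∈ Y, y * y = 0 → y = 0

namespace IsTriple

variable {Y Z W : Submodule F A} {S : Finset A}

/-- Transfers every result about `Z` to `W`. -/
theorem symm (hT : IsTriple Y Z W S) : IsTriple Y W Z S :=
  { hT.toIsPrimitiveFamily with
    mul_yy := hT.mul_yy
    mul_yz := hT.mul_yw
    mul_zy := hT.mul_wy
    mul_yw := hT.mul_yz
    mul_wy := hT.mul_zy
    mul_zw := hT.mul_wz
    mul_wz := hT.mul_zw
    mul_zz := hT.mul_ww
    mul_ww := hT.mul_zz
    comm := hT.comm
    reduced := hT.reduced }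

theorem exists_mul_ne_zero (hT : IsTriple Y Z W S) {y : A} (hy : y ∈ Y) (hy0 : y ≠ 0) :
    ∃ e ∈ S, e * y ≠ 0 := by
  by_contra! h
  exact hy0 ((hT.sum_mul y hy).symm.trans (Finset.sum_eq_zero h))

/-- Rescaling gives `ab = e`, so `ba` is a nonzero idempotent of `Y`. It is primitive because `eY =
F e`: a primitive `e'` below it satisfies `e' = b (a e' b) a`, a multiple of `ba`, hence `e' = ba`.
-/
theorem exists_isMatched [IsScalarTower F A A] [SMulCommClass F A A] (hT : IsTriple Y Z W S)
    {e z w : A} (he : e ∈ S) (hz : z ∈ Z) (hw : w ∈ W) (h0 : e * (z * w) ≠ 0) :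
    ∃ f ∈ S, ∃ b, IsMatched Z W e f (e * z) b := by
  have heY := hT.mem e he
  have hee := hT.idem e he
  obtain ⟨c, hc⟩ := hT.scal e he _ (hT.mul_zw z hz w hw)
  have hc0 : c ≠ 0 := by
    rintro rfl
    rw [zero_smul] at hc
    exact h0 hc
  set a := e * z with ha
  set b := c⁻¹ • (w * e) with hb
  have haZ : a ∈ Z := hT.mul_yz e heY z hz
  have hbW : b ∈ W := W.smul_mem _ (hT.mul_wy w hw e heY)
  have hea : e * a = a := by rw [ha, ← mul_assoc, hee]
  have hbe : b * e = b := by rw [hb, smul_mul_assoc, mul_assoc, hee]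
  have hab : a * b = e := by
    rw [ha, hb, mul_smul_comm, ← mul_assoc, mul_assoc e z w, hc, smul_mul_assoc, hee, smul_smul,
      inv_mul_cancel₀ hc0, one_smul]
  have hfY : b * a ∈ Y := hT.mul_wz b hbW a haZ
  have hff : b * a * (b * a) = b * a := by
    rw [mul_assoc, ← mul_assoc a b a, hab, hea]
  have hf0 : b * a ≠ 0 := by
    intro h
    have : a * (b * a) * b = e := by rw [← mul_assoc, hab, hea, hab]
    rw [h, mul_zero, zero_mul] at this
    exact hT.ne_zero e he this.symm
  obtain ⟨e', he', hne⟩ := hT.exists_mul_ne_zero hfY hf0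
  have heY' := hT.mem e' he'
  obtain ⟨d, hd⟩ := hT.scal e' he' _ hfY
  -- `ba` is idempotent, so the nonzero scalar `d` satisfies `d² = d`.
  have hd1 : d = 1 := by
    have h1 : d • e' * (b * a) = d • e' := by rw [← hd, mul_assoc, hff]
    rw [smul_mul_assoc, hd, smul_smul] at h1
    have hd0 : d ≠ 0 := by
      rintro rfl
      rw [zero_smul] at hd
      exact hne hd
    have h2 := smul_left_injective F (hT.ne_zero e' he') h1
    exact mul_left_cancel₀ hd0 (by rw [h2, mul_one])
  rw [hd1, one_smul] at hd
  have hd' : b * a * e' = e' := by rw [hT.comm _ hfY e' heY', hd]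
  have haeb : a * e' * b ∈ Y := hT.mul_zw _ (hT.mul_zy a haZ e' heY') b hbW
  obtain ⟨t, ht⟩ := hT.scal e he _ haeb
  rw [← mul_assoc, ← mul_assoc, hea] at ht
  have h3 : e' = t • (b * a) := by
    calc e' = b * a * e' * (b * a) := by rw [hd', hd]
      _ = b * (a * e' * b) * a := by simp only [mul_assoc]
      _ = t • (b * a) := by rw [ht, mul_smul_comm, hbe, smul_mul_assoc]
  have ht1 : t = 1 := by
    have h4 : e' * e' = t • e' := by
      nth_rewrite 1 [h3]
      rw [smul_mul_assoc, hd']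
    rw [hT.idem e' he'] at h4
    exact smul_left_injective F (hT.ne_zero e' he') (by simpa using h4.symm)
  rw [ht1, one_smul] at h3
  refine ⟨e', he', b, haZ, hbW, hab, h3.symm, hea, ?_, ?_, hbe⟩
  · rw [h3, ← mul_assoc, hab, hea]
  · rw [h3, mul_assoc, hab, hbe]

/-- Consecutive pairs would give `a = e a = b' (a' a)`, and `a' a = 0` since `ZZ = 0`. -/
theorem not_isMatched_chain (hT : IsTriple Y Z W S) {d e f a b a' b' : A}
    (he : e ∈ S) (h : IsMatched Z W e f a b) (h' : IsMatched Z W d e a' b') : False := by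
  have h1 : a' * a = 0 := hT.mul_zz a' h'.mem_left a h.mem_left
  have h2 : a = 0 := by rw [← h.e_mul, ← h'.mul_eq', mul_assoc, h1, mul_zero]
  apply hT.ne_zero e he
  rw [← h.mul_eq, h2, zero_mul]

/-- `b' a` lies in the corner from `f'` to `f`, but also in the commutative `Y`, so it vanishes when
`f ≠ f'`; then `a = a' (b' a) = 0`. -/
theorem isMatched_right_unique (hT : IsTriple Y Z W S) {e f f' a b a' b' : A}
    (he : e ∈ S) (hf : f ∈ S) (hf' : f' ∈ S) (h : IsMatched Z W e f a b)
    (h' : IsMatched Z W e f' a' b') : f = f' := by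
  by_contra hne
  have hY := hT.mul_wz b' h'.mem_right a h.mem_left
  have h1 : b' * a = 0 := by
    calc b' * a = f' * (b' * a) * f := by
          rw [← mul_assoc, h'.f_mul, mul_assoc, h.mul_f]
      _ = f' * f * (b' * a) := by
          rw [mul_assoc, hT.comm _ hY f (hT.mem f hf), mul_assoc]
      _ = 0 := by rw [hT.orth f' hf' f hf (Ne.symm hne), zero_mul]
  have h2 : a = 0 := by rw [← h.e_mul, ← h'.mul_eq, mul_assoc, h1, mul_zero]
  apply hT.ne_zero e he
  rw [← h.mul_eq, h2, zero_mul]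

theorem isMatched_left_unique (hT : IsTriple Y Z W S) {e e' f a b a' b' : A}
    (he : e ∈ S) (he' : e' ∈ S) (hf : f ∈ S) (h : IsMatched Z W e f a b)
    (h' : IsMatched Z W e' f a' b') : e = e' :=
  hT.symm.isMatched_right_unique hf he he' h.symm h'.symm

/-- `(wz)² = w (zw) z = 0` and `Y` is reduced. -/
theorem mul_eq_zero_swap (hT : IsTriple Y Z W S) {z w : A} (hz : z ∈ Z) (hw : w ∈ W)
    (h : z * w = 0) : w * z = 0 := by
  refine hT.reduced _ (hT.mul_wz w hw z hz) ?_
  rw [mul_assoc, ← mul_assoc z, h, zero_mul, mul_zero]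

/-- An element of `Z` minus its part in matched corners annihilates `W`. -/
theorem sub_matched_mul_eq_zero [IsScalarTower F A A] [SMulCommClass F A A]
    (hT : IsTriple Y Z W S) {z : A} (hz : z ∈ Z) (P : Finset (A × A))
    (hP : ∀ p, p ∈ P ↔ p.1 ∈ S ∧ p.2 ∈ S ∧ ∃ a b, IsMatched Z W p.1 p.2 a b) :
    ∀ w ∈ W, (z - ∑ p ∈ P, p.1 * z * p.2) * w = 0 := by
  classical
  intro w hw
  set z' := z - ∑ p ∈ P, p.1 * z * p.2 with hz'
  have hzZ : z' ∈ Z := Z.sub_mem hz <| Z.sum_mem fun p hp =>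
    hT.mul_zy _ (hT.mul_yz _ (hT.mem _ ((hP p).1 hp).1) z hz) _ (hT.mem _ ((hP p).1 hp).2.1)
  by_contra hne
  obtain ⟨e, he, h0⟩ := hT.exists_mul_ne_zero (hT.mul_zw z' hzZ w hw) hne
  obtain ⟨f, hf, b, hm⟩ := hT.exists_isMatched he hzZ hw h0
  -- By orthogonality only the corner `(e, f)` survives. Hence `e z' = e z' f = 0`, contradicting
  -- `(e z') b = e`.
  have h1 : e * (∑ p ∈ P, p.1 * z * p.2) * f = e * z * f := by
    rw [Finset.mul_sum, Finset.sum_mul, Finset.sum_eq_single (e, f)]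
    · simp only
      rw [mul_assoc, mul_assoc (e * z), hT.idem f hf, ← mul_assoc, ← mul_assoc, hT.idem e he]
    · intro p hp hpne
      obtain ⟨hp1, hp2, -⟩ := (hP p).1 hp
      by_cases h : e = p.1
      · have h' : p.2 ≠ f := fun h' => hpne (Prod.ext h.symm h')
        rw [mul_assoc, mul_assoc (p.1 * z), hT.orth _ hp2 f hf h', mul_zero, mul_zero]
      · rw [← mul_assoc, ← mul_assoc, hT.orth e he _ hp1 h, zero_mul, zero_mul, zero_mul]
    · intro h
      exact absurd ((hP (e, f)).2 ⟨he, hf, _, _, hm⟩) h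
  have h2 : e * z' = 0 := by
    rw [← hm.mul_f, hz', mul_sub, sub_mul, h1, sub_self]
  apply hT.ne_zero e he
  rw [← hm.mul_eq, h2, zero_mul]

/-- Matched corners of `Z` are one-dimensional. -/
theorem matched_corner [IsScalarTower F A A] (hT : IsTriple Y Z W S)
    {e f a b z : A} (he : e ∈ S) (hz : z ∈ Z) (h : IsMatched Z W e f a b) :
    ∃ c : F, e * z * f = c • a := by
  obtain ⟨c, hc⟩ := hT.scal e he _ (hT.mul_zw z hz b h.mem_right)
  refine ⟨c, ?_⟩
  rw [← h.mul_eq', ← mul_assoc, mul_assoc e z b, hc, smul_mul_assoc, h.e_mul]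

end IsTriple

end Matching

/-! ### Assembling the blocks and splitting off the radical -/

section Assembly

variable {F : Type u} [Field F] {G : Type w} [Group G] {A : Type v} [NonUnitalRing A] [Module F A]

/-- On the sum of the blocks, left multiplication by the unit `f i` is the projection onto `C i`.
Applied to an element of the radical it gives an element of `C i` in an ideal without nonzero
elements of degree 1, which is 0. -/
theorem exists_decomposition_of_blocks [SMulCommClass F A A] {𝒜 : G → Submodule F A} {g : G}
    {ι : Type*} [Finite ι]
    (C : ι → NonUnitalSubalgebra F A) (f : ι → A) (hC : ∀ i, IsBlock 𝒜 g (C i) (f i))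
    (horth : ∀ i j, i ≠ j → f i * f j = 0)
    (htop : ⊤ ≤ (⨆ i, (C i).toSubmodule) ⊔ gradedJacobson 𝒜)
    (hJ : ∀ y ∈ gradedJacobson 𝒜, y ∈ 𝒜 1 → y = 0) :
    ∃ B : NonUnitalSubalgebra F A,
      IsGradedSubspace 𝒜 B.toSubmodule ∧
      (∃ (s : ℕ) (C : Fin s → NonUnitalSubalgebra F A),
        (∀ i, IsGradedSubspace 𝒜 (C i).toSubmodule) ∧
        iSupIndep (fun i => (C i).toSubmodule) ∧
        ⨆ i, (C i).toSubmodule = B.toSubmodule ∧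
        (∀ i j, i ≠ j → ∀ a ∈ C i, ∀ b ∈ C j, a * b = 0) ∧
        ∀ i,
          GradedIsomorphic (subalgebraGrading 𝒜 (C i)) (trivialGrading F G) ∨
          GradedIsomorphic (subalgebraGrading 𝒜 (C i)) (matrixGrading F g)) ∧
      IsCompl B.toSubmodule (gradedJacobson 𝒜) := by
  classical
  cases nonempty_fintype ι
  have hmul : ∀ i j, i ≠ j → ∀ a ∈ C i, ∀ b ∈ C j, a * b = 0 := by
    intro i j hij a ha b hb
    rw [← (hC i).mul_one a ha, ← (hC j).one_mul b hb, mul_assoc, ← mul_assoc (f i),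
      horth i j hij, zero_mul, mul_zero]
  have hfmul : ∀ i j, i ≠ j → ∀ a ∈ C j, f i * a = 0 := by
    intro i j hij a ha
    rw [← (hC j).one_mul a ha, ← mul_assoc, horth i j hij, zero_mul]
  let D : Submodule F A := ⨆ i, (C i).toSubmodule
  have hDmul : ∀ a ∈ D, ∀ b ∈ D, a * b ∈ D := by
    intro a ha b hb
    induction ha using Submodule.iSup_induction' with
    | zero =>
      rw [zero_mul]
      exact D.zero_mem
    | add x y _ _ hx hy =>
      rw [add_mul]
      exact D.add_mem hx hy
    | mem i a ha =>
      induction hb using Submodule.iSup_induction' with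
      | zero =>
        rw [mul_zero]
        exact D.zero_mem
      | add x y _ _ hx hy =>
        rw [mul_add]
        exact D.add_mem hx hy
      | mem j b hb =>
        by_cases hij : i = j
        · subst hij
          exact Submodule.mem_iSup_of_mem i ((C i).mul_mem ha hb)
        · rw [hmul i j hij a ha b hb]
          exact D.zero_mem
  have hfD : ∀ i, ∀ x ∈ D, f i * x ∈ C i := by
    intro i x hx
    have hle : D ≤ (C i).toSubmodule.comap (LinearMap.mulLeft F (f i)) := by
      refine iSup_le fun j x hx => ?_
      show f i * x ∈ C i
      by_cases hij : i = j
      · subst hij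
        rw [(hC i).one_mul x hx]
        exact hx
      · rw [hfmul i j hij x hx]
        exact (C i).zero_mem
    exact hle hx
  have hsum : ∀ x ∈ D, ∑ i, f i * x = x := by
    intro x hx
    have hle : D ≤ LinearMap.eqLocus (∑ i, LinearMap.mulLeft F (f i)) LinearMap.id := by
      refine iSup_le fun j x hx => ?_
      rw [LinearMap.mem_eqLocus, LinearMap.sum_apply, Finset.sum_eq_single j]
      · exact (hC j).one_mul x hx
      · intro i _ hij
        exact hfmul i j hij x hx
      · intro h
        exact absurd (Finset.mem_univ j) h
    have := hle hx
    rwa [LinearMap.mem_eqLocus, LinearMap.sum_apply] at this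
  let e := (Fintype.equivFin ι).symm
  refine ⟨{ D with mul_mem' := fun {a b} ha hb => hDmul a ha b hb }, ?_,
    ⟨Fintype.card ι, C ∘ e, fun i => (hC _).graded, ?_, ?_,
      fun i j hij => hmul _ _ (e.injective.ne hij), fun i => (hC _).iso⟩, ?_, ?_⟩
  · show D = ⨆ h, D ⊓ 𝒜 h
    refine le_antisymm (iSup_le fun i => ?_) (iSup_le fun h => inf_le_left)
    rw [(hC i).graded]
    exact iSup_mono fun h => inf_le_inf_right _ (le_iSup (fun i => (C i).toSubmodule) i)
  · have hind : iSupIndep fun i => (C i).toSubmodule :=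
      iSupIndep_of_proj (fun i => LinearMap.mulLeft F (f i)) (fun i => (hC i).one_mul)
        fun i j hij => hfmul i j hij.symm
    exact hind.comp e.injective
  · exact e.iSup_comp (g := fun i => (C i).toSubmodule)
  · show Disjoint D _
    rw [Submodule.disjoint_def]
    intro x hx hxJ
    rw [← hsum x hx]
    refine Finset.sum_eq_zero fun i _ => ?_
    exact (hC i).eq_zero_of_mem_ideal (gradedJacobson 𝒜)
      (fun x hx a => ⟨mul_mem_gradedJacobson hx a, mul_mem_gradedJacobson' hx a⟩) hJ _
      (hfD i x hx) (mul_mem_gradedJacobson' hxJ (f i))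
  · exact codisjoint_iff_le_sup.2 htop

theorem exists_isTriple [IsScalarTower F A A] [SMulCommClass F A A] [Finite F] [Finite A]
    {𝒜 : G → Submodule F A} (h𝒜 : IsAlgebraGrading 𝒜)
    {g : G} (hid : ∀ f ∈ identitySet F g (Nat.card F), IsGradedIdentity 𝒜 f) :
    ∃ S, IsTriple (𝒜 1) (𝒜 g) (𝒜 g⁻¹) S := by
  classical
  have hpow : ∀ y ∈ 𝒜 1,
      (Unitization.inr y : Unitization F A) ^ Nat.card F = Unitization.inr y := by
    intro y hy
    have := hid (f₁ F G (Nat.card F)) (by simp [identitySet]) (fun p => if p.2 = 1 then y else 0)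
      (fun i h => by
        dsimp only
        split_ifs with h1
        · exact h1 ▸ hy
        · exact (𝒜 h).zero_mem)
    simpa [f₁, x, sub_eq_zero] using this
  have hsq : ∀ k, (k = g ∨ k = g⁻¹) → ∀ a ∈ 𝒜 k, ∀ b ∈ 𝒜 k, a * b = 0 := by
    intro k hk a ha b hb
    have := hid (x F 1 k * x F 2 k) (by rcases hk with rfl | rfl <;> simp [identitySet, f₃, f₄])
      (fun p => if p.2 = k then if p.1 = 1 then a else b else 0)
      (fun i h => by
        dsimp only
        split_ifs with h1 h2
        · exact h1 ▸ ha
        · exact h1 ▸ hb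
        · exact (𝒜 h).zero_mem)
    have h2 : (Unitization.inr (a * b) : Unitization F A) = 0 := by
      simpa [x] using this
    exact Unitization.inr_injective (R := F) (h2.trans (Unitization.inr_zero F).symm)
  have hyy : ∀ a ∈ 𝒜 1, ∀ b ∈ 𝒜 1, a * b ∈ 𝒜 1 := fun a ha b hb => by
    simpa using h𝒜.mul_mem 1 1 a ha b hb
  have hspan := fun y hy => mem_span_idempotents hyy hpow (y := y) hy
  have hred := fun y (hy : y ∈ 𝒜 1) => eq_zero_of_mul_self_eq_zero (hpow y hy)
  have hcomm := commute_of_reduced hyy hred hspan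
  obtain ⟨S, hS⟩ := exists_isPrimitiveFamily hyy hcomm hspan
  exact ⟨S,
    { hS with
      mul_yy := hyy
      mul_yz := fun a ha b hb => by simpa using h𝒜.mul_mem 1 g a ha b hb
      mul_zy := fun a ha b hb => by simpa using h𝒜.mul_mem g 1 a ha b hb
      mul_yw := fun a ha b hb => by simpa using h𝒜.mul_mem 1 g⁻¹ a ha b hb
      mul_wy := fun a ha b hb => by simpa using h𝒜.mul_mem g⁻¹ 1 a ha b hb
      mul_zw := fun a ha b hb => by simpa using h𝒜.mul_mem g g⁻¹ a ha b hb
      mul_wz := fun a ha b hb => by simpa using h𝒜.mul_mem g⁻¹ g a ha b hb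
      mul_zz := hsq g (Or.inl rfl)
      mul_ww := hsq g⁻¹ (Or.inr rfl)
      comm := hcomm
      reduced := hred }⟩

theorem sup_eq_top_of_identities [IsScalarTower F A A] [SMulCommClass F A A]
    {𝒜 : G → Submodule F A} (h𝒜 : IsAlgebraGrading 𝒜) {g : G} {q : ℕ}
    (hid : ∀ f ∈ identitySet F g q, IsGradedIdentity 𝒜 f) : 𝒜 1 ⊔ 𝒜 g ⊔ 𝒜 g⁻¹ = ⊤ := by
  classical
  rw [eq_top_iff, ← h𝒜.span]
  refine iSup_le fun h => ?_
  by_cases hh : h ∈ ({1, g, g⁻¹} : Set G)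
  · rcases hh with rfl | rfl | rfl
    · exact le_sup_left.trans le_sup_left
    · exact le_sup_right.trans le_sup_left
    · exact le_sup_right
  · intro a ha
    have := hid (x F 1 h) (Or.inr ⟨h, hh, rfl⟩) (fun p => if p.2 = h then a else 0)
      (fun i k => by
        dsimp only
        split_ifs with h1
        · exact h1 ▸ ha
        · exact (𝒜 k).zero_mem)
    have h2 : (Unitization.inr a : Unitization F A) = 0 := by simpa [x] using this
    rw [Unitization.inr_injective (R := F) (h2.trans (Unitization.inr_zero F).symm)]
    exact Submodule.zero_mem _

/-- Elements of degree `g` that annihilate the component of degree `g⁻¹` are in the radical. -/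
theorem mem_gradedJacobson_of_mul_eq_zero [IsScalarTower F A A] {𝒜 : G → Submodule F A}
    {Y Z W : Submodule F A}
    {S : Finset A} (hT : IsTriple Y Z W S) (htop : Y ⊔ Z ⊔ W = ⊤) {k : G} (hk : 𝒜 k = Z)
    {z : A} (hz : z ∈ Z) (h : ∀ w ∈ W, z * w = 0) : z ∈ gradedJacobson 𝒜 := by
  -- `T` is a left ideal: `Y T ⊆ T`, while `Z T = 0` by `ZZ = 0` and `W T = 0` by
  -- `mul_eq_zero_swap`.
  let T : Submodule F A :=
    { carrier := {z | z ∈ Z ∧ ∀ w ∈ W, z * w = 0}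
      zero_mem' := ⟨Z.zero_mem, fun w _ => zero_mul w⟩
      add_mem' := fun ha hb => ⟨Z.add_mem ha.1 hb.1, fun w hw => by
        rw [add_mul, ha.2 w hw, hb.2 w hw, add_zero]⟩
      smul_mem' := fun c a ha => ⟨Z.smul_mem c ha.1, fun w hw => by
        rw [smul_mul_assoc, ha.2 w hw, smul_zero]⟩ }
  refine le_gradedJacobson_of_mul_eq_zero (T := T) (k := k) (fun t ht => hk ▸ ht.1) ?_
    (fun s hs t ht => hT.mul_zz s hs.1 t ht.1) ⟨hz, h⟩
  intro a t ht
  have hle : Y ⊔ Z ⊔ W ≤ T.comap (LinearMap.mulRight F t) := by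
    refine sup_le (sup_le ?_ ?_) ?_
    · intro a ha
      exact ⟨hT.mul_yz a ha t ht.1, fun w hw => by
        rw [LinearMap.mulRight_apply, mul_assoc, ht.2 w hw, mul_zero]⟩
    · intro a ha
      rw [Submodule.mem_comap, LinearMap.mulRight_apply, hT.mul_zz a ha t ht.1]
      exact T.zero_mem
    · intro a ha
      rw [Submodule.mem_comap, LinearMap.mulRight_apply,
        hT.mul_eq_zero_swap ht.1 ha (ht.2 a ha)]
      exact T.zero_mem
  exact hle (htop ▸ Submodule.mem_top)

/-- Once a subspace contains all the matrix units, together with the radical it contains `Z`. -/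
theorem le_sup_gradedJacobson [IsScalarTower F A A] [SMulCommClass F A A] {𝒜 : G → Submodule F A}
    {Y Z W : Submodule F A} {S : Finset A} (hT : IsTriple Y Z W S) (htop : Y ⊔ Z ⊔ W = ⊤)
    {k : G} (hk : 𝒜 k = Z) {D : Submodule F A}
    (hD : ∀ e ∈ S, ∀ f ∈ S, ∀ a b, IsMatched Z W e f a b →
      ∃ a' b', IsMatched Z W e f a' b' ∧ a' ∈ D) : Z ≤ D ⊔ gradedJacobson 𝒜 := by
  classical
  intro z hz
  let P : Finset (A × A) := (S ×ˢ S).filter fun p => ∃ a b, IsMatched Z W p.1 p.2 a b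
  have hP : ∀ p, p ∈ P ↔ p.1 ∈ S ∧ p.2 ∈ S ∧ ∃ a b, IsMatched Z W p.1 p.2 a b := by
    intro p
    rw [Finset.mem_filter, Finset.mem_product, and_assoc]
  have hmem : ∀ p ∈ P, p.1 * z * p.2 ∈ D ∧ p.1 * z * p.2 ∈ Z := by
    intro p hp
    obtain ⟨h1, h2, a, b, hm⟩ := (hP p).1 hp
    obtain ⟨a', b', hm', ha'⟩ := hD _ h1 _ h2 a b hm
    obtain ⟨c, hc⟩ := hT.matched_corner h1 hz hm'
    rw [hc]
    exact ⟨D.smul_mem c ha', Z.smul_mem c hm'.mem_left⟩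
  have hJ : z - ∑ p ∈ P, p.1 * z * p.2 ∈ gradedJacobson 𝒜 :=
    mem_gradedJacobson_of_mul_eq_zero hT htop hk
      (Z.sub_mem hz (Z.sum_mem fun p hp => (hmem p hp).2)) (hT.sub_matched_mul_eq_zero hz P hP)
  rw [← sub_add_cancel z (∑ p ∈ P, p.1 * z * p.2), add_comm]
  exact Submodule.add_mem_sup (D.sum_mem fun p hp => (hmem p hp).1) hJ

/-- If `y ≠ 0`, some `e y` is a nonzero multiple of `e`, which would put the idempotent `e` in the
radical. -/
theorem gradedJacobson_inf_degree_one [IsScalarTower F A A] [SMulCommClass F A A]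
    [FiniteDimensional F A] {𝒜 : G → Submodule F A}
    (h𝒜 : IsAlgebraGrading 𝒜) {Z W : Submodule F A} {S : Finset A} (hT : IsTriple (𝒜 1) Z W S)
    {y : A} (hyJ : y ∈ gradedJacobson 𝒜) (hy : y ∈ 𝒜 1) : y = 0 := by
  by_contra hy0
  obtain ⟨e, he, hne⟩ := hT.exists_mul_ne_zero hy hy0
  obtain ⟨c, hc⟩ := hT.scal e he y hy
  have hc0 : c ≠ 0 := by
    rintro rfl
    rw [zero_smul] at hc
    exact hne hc
  refine notMem_gradedJacobson_of_idempotent h𝒜 (hT.mem e he) (hT.idem e he) (hT.ne_zero e he) ?_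
  have h1 : c • e ∈ gradedJacobson 𝒜 := hc ▸ mul_mem_gradedJacobson' hyJ e
  exact ((gradedJacobson 𝒜).smul_mem_iff hc0).1 h1

end Assembly

end GradedPI

theorem mainTheorem6 {F : Type*} [Field F] [Finite F] (q : ℕ) (hq : Nat.card F = q)
    {G : Type*} [Group G] (g : G) (hg : Subgroup.zpowers g = ⊤) (hG : 2 < ENat.card G)
    {A : Type*} [NonUnitalRing A] [Module F A] [IsScalarTower F A A] [SMulCommClass F A A]
    [FiniteDimensional F A]
    (𝒜 : G → Submodule F A) (h𝒜 : GradedPI.IsAlgebraGrading 𝒜)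
    (hid : ∀ f ∈ GradedPI.identitySet F g q, GradedPI.IsGradedIdentity 𝒜 f) :
    ∃ B : NonUnitalSubalgebra F A,
      GradedPI.IsGradedSubspace 𝒜 B.toSubmodule ∧
      (∃ (s : ℕ) (C : Fin s → NonUnitalSubalgebra F A),
        (∀ i, GradedPI.IsGradedSubspace 𝒜 (C i).toSubmodule) ∧
        iSupIndep (fun i => (C i).toSubmodule) ∧
        ⨆ i, (C i).toSubmodule = B.toSubmodule ∧
        (∀ i j, i ≠ j → ∀ a ∈ C i, ∀ b ∈ C j, a * b = 0) ∧
        ∀ i,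
          GradedPI.GradedIsomorphic (GradedPI.subalgebraGrading 𝒜 (C i))
            (GradedPI.trivialGrading F G) ∨
          GradedPI.GradedIsomorphic (GradedPI.subalgebraGrading 𝒜 (C i))
            (GradedPI.matrixGrading F g)) ∧
      IsCompl B.toSubmodule (GradedPI.gradedJacobson 𝒜) := by
  classical
  subst hq
  have : Finite A := Module.finite_of_finite F
  obtain ⟨S, hT⟩ := GradedPI.exists_isTriple h𝒜 hid
  have htop := GradedPI.sup_eq_top_of_identities h𝒜 hid
  -- `I` indexes the matrix blocks by matched pairs, `I'` the blocks `F e` by the idempotents in no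
  -- pair.
  let I := {p : A × A // p.1 ∈ S ∧ p.2 ∈ S ∧
    ∃ a b, GradedPI.IsMatched (𝒜 g) (𝒜 g⁻¹) p.1 p.2 a b}
  let I' := {e : A // e ∈ S ∧ ∀ p : I, e ≠ p.1.1 ∧ e ≠ p.1.2}
  have hne : ∀ p p' : I, p.1.1 ≠ p'.1.2 := by
    rintro ⟨⟨e, f⟩, he, hf, a, b, hm⟩ ⟨⟨e', f'⟩, he', hf', a', b', hm'⟩ h
    dsimp only at h he hf hm he' hf' hm'
    subst h
    exact hT.not_isMatched_chain he hm hm'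
  have hM : ∀ p : I, ∃ C : NonUnitalSubalgebra F A, GradedPI.IsBlock 𝒜 g C (p.1.1 + p.1.2) ∧
      p.1.1 ∈ C ∧ p.1.2 ∈ C ∧
      ∃ a b, GradedPI.IsMatched (𝒜 g) (𝒜 g⁻¹) p.1.1 p.1.2 a b ∧ a ∈ C ∧ b ∈ C := by
    intro p
    obtain ⟨he, hf, a, b, hm⟩ := p.2
    obtain ⟨C, hC, h1, h2, h3, h4⟩ := GradedPI.exists_isBlock_of_isMatched
      h𝒜.toIsVectorGrading hm (hT.mem _ he) (hT.mem _ hf) (hT.idem _ he) (hT.idem _ hf)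
      (hT.orth _ he _ hf (hne p p)) (hT.orth _ hf _ he (hne p p).symm) (hT.ne_zero _ he)
    exact ⟨C, hC, h1, h2, a, b, hm, h3, h4⟩
  choose C hC hC₁ hC₂ a b hm ha hb using hM
  have hM' : ∀ e : I', ∃ C : NonUnitalSubalgebra F A, GradedPI.IsBlock 𝒜 g C e.1 ∧ e.1 ∈ C :=
    fun e => GradedPI.exists_isBlock_of_idempotent h𝒜.toIsVectorGrading g (hT.mem _ e.2.1)
      (hT.idem _ e.2.1) (hT.ne_zero _ e.2.1)
  choose C' hC' he' using hM'
  let K : I ⊕ I' → NonUnitalSubalgebra F A := Sum.elim C C'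
  have hleft : ∀ p, (C p).toSubmodule ≤ ⨆ i, (K i).toSubmodule := fun p =>
    le_iSup (fun i => (K i).toSubmodule) (Sum.inl p)
  have hright : ∀ e, (C' e).toSubmodule ≤ ⨆ i, (K i).toSubmodule := fun e =>
    le_iSup (fun i => (K i).toSubmodule) (Sum.inr e)
  refine GradedPI.exists_decomposition_of_blocks (ι := I ⊕ I') K
    (Sum.elim (fun p => p.1.1 + p.1.2) fun e => e.1) ?_ ?_ ?_
    (fun y hyJ hy => GradedPI.gradedJacobson_inf_degree_one h𝒜 hT hyJ hy)
  · rintro (p | e)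
    · exact hC p
    · exact hC' e
  -- Distinct pairs share no idempotent: equal first or second entries are excluded by uniqueness of
  -- partners, mixed ones by `hne`. Orthogonality of the block units then reduces to that of `S`.
  · have h11 : ∀ p p' : I, p ≠ p' → p.1.1 ≠ p'.1.1 := by
      rintro ⟨⟨e, f⟩, he, hf, a, b, hm⟩ ⟨⟨e', f'⟩, he', hf', a', b', hm'⟩ hpp h
      dsimp only at h he hf hm he' hf' hm'
      subst h
      have := hT.isMatched_right_unique he hf hf' hm hm'
      subst this
      exact hpp rfl
    have h22 : ∀ p p' : I, p ≠ p' → p.1.2 ≠ p'.1.2 := by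
      rintro ⟨⟨e, f⟩, he, hf, a, b, hm⟩ ⟨⟨e', f'⟩, he', hf', a', b', hm'⟩ hpp h
      dsimp only at h he hf hm he' hf' hm'
      subst h
      have := hT.isMatched_left_unique he he' hf hm hm'
      subst this
      exact hpp rfl
    rintro (p | e) (p' | e') hij
    · have hpp : p ≠ p' := fun h => hij (h ▸ rfl)
      simp only [Sum.elim_inl]
      rw [add_mul, mul_add, mul_add, hT.orth _ p.2.1 _ p'.2.1 (h11 p p' hpp),
        hT.orth _ p.2.1 _ p'.2.2.1 (hne p p'), hT.orth _ p.2.2.1 _ p'.2.1 (hne p' p).symm,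
        hT.orth _ p.2.2.1 _ p'.2.2.1 (h22 p p' hpp)]
      simp
    · simp only [Sum.elim_inl, Sum.elim_inr]
      rw [add_mul, hT.orth _ p.2.1 _ e'.2.1 (e'.2.2 p).1.symm,
        hT.orth _ p.2.2.1 _ e'.2.1 (e'.2.2 p).2.symm, add_zero]
    · simp only [Sum.elim_inl, Sum.elim_inr]
      rw [mul_add, hT.orth _ e.2.1 _ p'.2.1 (e.2.2 p').1,
        hT.orth _ e.2.1 _ p'.2.2.1 (e.2.2 p').2, add_zero]
    · exact hT.orth _ e.2.1 _ e'.2.1 fun h => hij (congrArg Sum.inr (Subtype.ext h))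
  · rw [← htop]
    refine sup_le (sup_le ?_ ?_) ?_
    · intro y hy
      refine Submodule.mem_sup_left ?_
      rw [← hT.sum_mul y hy]
      refine Submodule.sum_mem _ fun e he => ?_
      obtain ⟨c, hc⟩ := hT.scal e he y hy
      rw [hc]
      refine Submodule.smul_mem _ c ?_
      by_cases h : ∀ p : I, e ≠ p.1.1 ∧ e ≠ p.1.2
      · exact hright ⟨e, he, h⟩ (he' ⟨e, he, h⟩)
      · push Not at h
        obtain ⟨p, hp⟩ := h
        by_cases h1 : e = p.1.1
        · exact hleft p (h1 ▸ hC₁ p)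
        · exact hleft p (hp h1 ▸ hC₂ p)
    · exact GradedPI.le_sup_gradedJacobson hT htop rfl fun e he f hf s t hst =>
        ⟨_, _, hm ⟨(e, f), he, hf, s, t, hst⟩, hleft _ (ha _)⟩
    · refine GradedPI.le_sup_gradedJacobson hT.symm (by rw [← htop, sup_right_comm]) rfl
        fun e he f hf s t hst =>
          ⟨_, _, (hm ⟨(f, e), hf, he, t, s, hst.symm⟩).symm, hleft _ (hb _)⟩
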